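/- **Setting.** Let $N\ge 1$. For $i=1,\dots,N$ let $n_i,m_i\ge1$, $\Lambda_i^+=\mathrm{diag}(\lambda_i^1,\dots,\lambda_i^{n_i})$, $\Lambda_i^-=\mathrm{diag}(\mu_i^1,\dots,\mu_i^{m_i})$ with $0<\lambda_i^1<\dots<\lambda_i^{n_i}$, $0<\mu_i^1<\dots<\mu_i^{m_i}$, and let $\Sigma_i^{++},\Sigma_i^{+-},\Sigma_i^{-+},\Sigma_i^{--}$ be continuous matrix functions on $[0,1]$, where $\Sigma_i^{++},\Sigma_i^{--}$ have zero diagonal. Let $Q_{i,i},R_{i,i}$, $Q_{i+1,i}\in\mathbb R^{n_{i+1}\times n_i}$ ($i<N$) and $R_{i,i+1}$ be constant matrices, with $R_{N,N+1}=0$ and the convention $v_{N+1}(t,0)\equiv0$. Consider the chain, for $t>0$, $x\in(0,1)$, $$\partial_t u_i+\Lambda_i^+\partial_x u_i=\Sigma_i^{++}(x)u_i+\Sigma_i^{+-}(x)v_i,\qquad \partial_t v_i-\Lambda_i^-\partial_x v_i=\Sigma_i^{-+}(x)u_i+\Sigma_i^{--}(x)v_i,$$ with the boundary conditions, for $t\ge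 0$, $$u_1(t,0)=Q_{1,1}v_1(t,0)+U(t),\qquad u_i(t,0)=Q_{i,i}v_i(t,0)+Q_{i,i-1}u_{i-1}(t,1)\ (i\ge2),\qquad v_i(t,1)=R_{i,i}u_i(t,1)+R_{i,i+1}v_{i+1}(t,0),$$ with an arbitrary input $U$ and the measured output $y(t)=u_N(t,1)$. Solutions are continuous on $[0,\infty)\times[0,1]$ and satisfy the PDEs in the sense of derivatives along the characteristic directions. Assume that $\operatorname{rank}Q_{i,i-1}=n_{i-1}$ for $i=2,\dots,N$. Let $\Lambda_i=\mathrm{diag}(\Lambda_i^+,-\Lambda_i^-)$, $\Sigma_i=\begin{pmatrix}\Sigma_i^{++}&\Sigma_i^{+-}\\ \Sigma_i^{-+}&\Sigma_i^{--}\end{pmatrix}$, and let $K_i=\begin{pmatrix}K_i^{uu}&K_i^{uv}\\K_i^{vu}&K_i^{vv}\end{pmatrix}$ on $\{0\le x\le y\le1\}$, $G_i$ strictly upper triangular on $[0,1]$, and $F_i$ on $\{0\le x\le 1,\ 0\le y\le x/\lambda_i^1\}$ be piecewise continuous and solve (along characteristics) $$\Lambda_i\partial_xK_i+\partial_yK_i\Lambda_i=-K_i\Sigma_i(y)+\begin{pmatrix}G_i(x)&0\\0&0\end{pmatrix}K_i,\quad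 \Lambda_iK_i(x,x)-K_i(x,x)\Lambda_i=\Sigma_i(x)-\begin{pmatrix}G_i(x)&0\\0&0\end{pmatrix},\quad K_i^{uu}(x,1)\Lambda_i^+=K_i^{uv}(x,1)\Lambda_i^-R_{i,i},$$ $$\Lambda_i^+\partial_xF_i+\partial_yF_i=G_i(x)F_i,\quad F_i(x,0)=-K_i^{uv}(x,1)\Lambda_i^-R_{i,i+1},\quad (F_i(x,x/\lambda_i^1))_{k\ell}=0\ (k>1).$$ For $t\ge 1/\lambda_i^1$ put $$\alpha_i(t,x)=u_i(t,x)+\int_0^{x/\lambda_i^1}F_i(x,y)v_{i+1}(t-y,0)\,dy+\int_x^1\big(K_i^{uu}(x,y)u_i(t,y)+K_i^{uv}(x,y)v_i(t,y)\big)dy.$$ Fix $\tau>\sum_{j=1}^N 1/\lambda_j^1$ and write $\bar\gamma(t)=\gamma(t-\tau)$. **Lemma 1.** There are continuous linear operators, depending neither on the solution nor on $U$, that map a measurement signal $y$ to signals $\hat\alpha_i(\cdot,1)$ and $\hat v_{i+1}(\cdot,0)$ on $\mathbb R$, $i=1,\dots,N$ (signals are continuous functions on $\mathbb R$ with locally uniform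 convergence; $y$ is extended to $t<0$ in any continuous way), such that for every $i$: 1. (causality) for all $t\ge0$ and $\nu\in[0,\sum_{j=1}^i1/\lambda_j^1]$, the values $\hat\alpha_i(t+\nu,1)$ and $\hat v_{i+1}(t+\nu,0)$ depend only on $y|_{[0,t]}$; 2. (exactness) for every input $U$ and every solution with output $y$, for all $t\ge 0$ and $\nu\in[0,\sum_{j=1}^i1/\lambda_j^1]$, $$\hat\alpha_i(t+\nu,1)=\bar\alpha_i(t+\nu,1)\quad\text{if } t+\nu\ge\tau+\tfrac1{\lambda_i^1}+\sum_{j=i+1}^N\tfrac1{\mu_j^1},\qquad \hat v_{i+1}(t+\nu,0)=\bar v_{i+1}(t+\nu,0)\quad\text{if } t+\nu\ge\tau+\sum_{j=i+1}^N\tfrac1{\mu_j^1}.$$ Moreover the estimators are given recursively from $i=N$ back to $i=1$: $\hat\alpha_N(s,1)=\bar y(s)$ for $s\ge\tau$ and $\hat v_{N+1}(\cdot,0)=0$, and for $1\le i<N$ there is a continuous linear operator $\Phi_i$ on signals with $(\hat\alpha_i(\cdot,1),\hat v_{i+1}(\cdot,0))=\Phi_i(\hat\alpha_{i+1}(\cdot,1),\hat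 v_{i+2}(\cdot,0))$ for every measurement signal $y$, where the output of $\Phi_i$ at time $s$ depends only on its input up to time $s+1/\lambda_{i+1}^1$. -/

import Mathlib

open Set
open scoped Matrix

noncomputable section

/-- A chain of `N` subsystems of `n i + m i` heterodirectional linear transport equations,
`i = 1, …, N`.  The families are indexed by `ℕ`; only the entries with `1 ≤ i ≤ N` matter (and,
through the zero matrix `Rdown N`, the dimension `m (N + 1)`), the other ones are padding. -/
structure ChainSystem where
  /-- number of subsystems -/
  N : ℕ
  N_pos : 0 < N
  /-- number of rightward (`n`) and leftward (`m`) propagating states -/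
  n : ℕ → ℕ
  m : ℕ → ℕ
  n_pos : ∀ i, 0 < n i
  m_pos : ∀ i, 0 < m i
  /-- transport velocities: `Λ_i^+ = diag (lam i)`, `Λ_i^- = diag (mu i)` -/
  lam : (i : ℕ) → Fin (n i) → ℝ
  mu : (i : ℕ) → Fin (m i) → ℝ
  lam_pos : ∀ i, 1 ≤ i → i ≤ N → ∀ k, 0 < lam i k
  mu_pos : ∀ i, 1 ≤ i → i ≤ N → ∀ k, 0 < mu i k
  lam_strictMono : ∀ i, 1 ≤ i → i ≤ N → StrictMono (lam i)
  mu_strictMono : ∀ i, 1 ≤ i → i ≤ N → StrictMono (mu i)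
  /-- in-domain couplings `Σ_i^{++}, Σ_i^{+-}, Σ_i^{-+}, Σ_i^{--}` -/
  Spp : (i : ℕ) → ℝ → Matrix (Fin (n i)) (Fin (n i)) ℝ
  Spm : (i : ℕ) → ℝ → Matrix (Fin (n i)) (Fin (m i)) ℝ
  Smp : (i : ℕ) → ℝ → Matrix (Fin (m i)) (Fin (n i)) ℝ
  Smm : (i : ℕ) → ℝ → Matrix (Fin (m i)) (Fin (m i)) ℝ
  Spp_cont : ∀ i, 1 ≤ i → i ≤ N → ContinuousOn (Spp i) (Icc 0 1)
  Spm_cont : ∀ i, 1 ≤ i → i ≤ N → ContinuousOn (Spm i) (Icc 0 1)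
  Smp_cont : ∀ i, 1 ≤ i → i ≤ N → ContinuousOn (Smp i) (Icc 0 1)
  Smm_cont : ∀ i, 1 ≤ i → i ≤ N → ContinuousOn (Smm i) (Icc 0 1)
  Spp_diag : ∀ i, 1 ≤ i → i ≤ N → ∀ x ∈ Icc (0 : ℝ) 1, ∀ k, Spp i x k k = 0
  Smm_diag : ∀ i, 1 ≤ i → i ≤ N → ∀ x ∈ Icc (0 : ℝ) 1, ∀ k, Smm i x k k = 0
  /-- `Q i` is `Q_{i,i}`, `Qup i` is `Q_{i+1,i}`, `R i` is `R_{i,i}`, `Rdown i` is `R_{i,i+1}` -/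
  Q : (i : ℕ) → Matrix (Fin (n i)) (Fin (m i)) ℝ
  Qup : (i : ℕ) → Matrix (Fin (n (i + 1))) (Fin (n i)) ℝ
  R : (i : ℕ) → Matrix (Fin (m i)) (Fin (n i)) ℝ
  Rdown : (i : ℕ) → Matrix (Fin (m i)) (Fin (m (i + 1))) ℝ
  /-- the convention `R_{N,N+1} = 0` -/
  Rdown_last : Rdown N = 0

namespace ChainSystem

variable (S : ChainSystem)

/-- The slowest rightward velocity `λ_i^1`. -/
def lam1 (i : ℕ) : ℝ := S.lam i ⟨0, S.n_pos i⟩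

/-- The slowest leftward velocity `μ_i^1`. -/
def mu1 (i : ℕ) : ℝ := S.mu i ⟨0, S.m_pos i⟩

/-- The signal `v_{i+1}(t,0)` that enters subsystem `i` from downstream, with the convention
`v_{N+1}(t,0) = 0`. -/
def vNext (v : (i : ℕ) → ℝ → ℝ → Fin (S.m i) → ℝ) (i : ℕ) (t : ℝ) : Fin (S.m (i + 1)) → ℝ :=
  if i < S.N then v (i + 1) t 0 else 0

/-- `(u, v)` is a solution of the chain on `t ≥ 0`, `x ∈ [0,1]`, with control input `U`.
The states are continuous up to the boundary; `∂_t + λ ∂_x` and `∂_t - μ ∂_x` are the derivatives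
in the directions `(1, λ)` and `(1, -μ)`.  As the right-hand sides are continuous, this is the same
as being a continuous solution in the sense of distributions, and it contains all solutions
in `C⁰([0,∞); H¹) ∩ C¹([0,∞); L²)`. -/
structure IsSolution (U : ℝ → Fin (S.n 1) → ℝ) (u : (i : ℕ) → ℝ → ℝ → Fin (S.n i) → ℝ)
    (v : (i : ℕ) → ℝ → ℝ → Fin (S.m i) → ℝ) : Prop where
  cont_u : ∀ i, 1 ≤ i → i ≤ S.N →
    ContinuousOn (fun p : ℝ × ℝ => u i p.1 p.2) (Ici 0 ×ˢ Icc 0 1)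
  cont_v : ∀ i, 1 ≤ i → i ≤ S.N →
    ContinuousOn (fun p : ℝ × ℝ => v i p.1 p.2) (Ici 0 ×ˢ Icc 0 1)
  pde_u : ∀ i, 1 ≤ i → i ≤ S.N → ∀ t, 0 < t → ∀ x ∈ Ioo (0 : ℝ) 1, ∀ k,
    HasDerivAt (fun s => u i (t + s) (x + S.lam i k * s) k)
      ((S.Spp i x *ᵥ u i t x + S.Spm i x *ᵥ v i t x) k) 0
  pde_v : ∀ i, 1 ≤ i → i ≤ S.N → ∀ t, 0 < t → ∀ x ∈ Ioo (0 : ℝ) 1, ∀ k,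
    HasDerivAt (fun s => v i (t + s) (x - S.mu i k * s) k)
      ((S.Smp i x *ᵥ u i t x + S.Smm i x *ᵥ v i t x) k) 0
  bc_input : ∀ t, 0 ≤ t → u 1 t 0 = S.Q 1 *ᵥ v 1 t 0 + U t
  bc_u : ∀ i, 1 ≤ i → i < S.N → ∀ t, 0 ≤ t →
    u (i + 1) t 0 = S.Q (i + 1) *ᵥ v (i + 1) t 0 + S.Qup i *ᵥ u i t 1
  bc_v : ∀ i, 1 ≤ i → i ≤ S.N → ∀ t, 0 ≤ t →
    v i t 1 = S.R i *ᵥ u i t 1 + S.Rdown i *ᵥ S.vNext v i t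

end ChainSystem

/-- Piecewise continuity on `D`: finitely many convex pieces cover `D`, and on each of them `f`
coincides with a function that is continuous on the whole space. -/
def PiecewiseContinuousOn {E : Type*} [TopologicalSpace E] [AddCommGroup E] [Module ℝ E]
    (f : E → ℝ) (D : Set E) : Prop :=
  ∃ (r : ℕ) (P : Fin r → Set E) (g : Fin r → E → ℝ),
    (∀ j, Convex ℝ (P j)) ∧ (∀ j, Continuous (g j)) ∧ D ⊆ ⋃ j, P j ∧
      ∀ j, ∀ z ∈ D ∩ P j, f z = g j z

namespace ChainSystem

variable (S : ChainSystem)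

/-- Index set of the full state `(u_i, v_i)` of subsystem `i`. -/
abbrev Idx (i : ℕ) : Type := Fin (S.n i) ⊕ Fin (S.m i)

/-- Diagonal of `Λ_i = diag (Λ_i^+, -Λ_i^-)`. -/
def speed (i : ℕ) : S.Idx i → ℝ := Sum.elim (S.lam i) (fun k => -S.mu i k)

/-- The full in-domain coupling matrix `Σ_i`. -/
def Sig (i : ℕ) (x : ℝ) : Matrix (S.Idx i) (S.Idx i) ℝ :=
  Matrix.fromBlocks (S.Spp i x) (S.Spm i x) (S.Smp i x) (S.Smm i x)

/-- Kernels of the time-affine backstepping transformation: `K i = (K^{uu} K^{uv}; K^{vu} K^{vv})`,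
the time-affine kernel `F i`, and the residual coupling `G i`. -/
structure Kernels where
  K : (i : ℕ) → ℝ → ℝ → Matrix (S.Idx i) (S.Idx i) ℝ
  F : (i : ℕ) → ℝ → ℝ → Matrix (Fin (S.n i)) (Fin (S.m (i + 1))) ℝ
  G : (i : ℕ) → ℝ → Matrix (Fin (S.n i)) (Fin (S.n i)) ℝ

/-- Domain of `K i`. -/
def triK : Set (ℝ × ℝ) := {p | 0 ≤ p.1 ∧ p.1 ≤ p.2 ∧ p.2 ≤ 1}

/-- Domain of `F i`. -/
def triF (i : ℕ) : Set (ℝ × ℝ) := {p | p.1 ∈ Icc (0 : ℝ) 1 ∧ 0 ≤ p.2 ∧ p.2 ≤ p.1 / S.lam1 i}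

/-- The matrix `diag (G_i(x), 0)`. -/
def Kernels.Gfull {S : ChainSystem} (κ : S.Kernels) (i : ℕ) (x : ℝ) :
    Matrix (S.Idx i) (S.Idx i) ℝ :=
  Matrix.fromBlocks (κ.G i x) 0 0 0

/-- The kernel equations of subsystem `i`.  The kernels are piecewise continuous only, so their
transport equations `Λ ∂ₓK + ∂_yK Λ = -K Σ(y) + diag(G,0) K` and `Λ⁺ ∂ₓF + ∂_yF = G F` are
integrated along the characteristic lines of each entry.  Where the data of two edges clash, which
is at a corner of the domain only, the value of one of them is taken.  The entries of `K^{vv}`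
whose remaining edge data are arbitrary are not constrained there. -/
structure Kernels.IsBackstepping {S : ChainSystem} (κ : S.Kernels) (i : ℕ) : Prop where
  pc_K : ∀ p q, PiecewiseContinuousOn (fun z : ℝ × ℝ => κ.K i z.1 z.2 p q) triK
  pc_F : ∀ k l, PiecewiseContinuousOn (fun z : ℝ × ℝ => κ.F i z.1 z.2 k l) (S.triF i)
  pc_G : ∀ k l, PiecewiseContinuousOn (fun x : ℝ => κ.G i x k l) (Icc 0 1)
  /-- `G` is strictly upper triangular -/
  G_upper : ∀ x ∈ Icc (0 : ℝ) 1, ∀ k l, l ≤ k → κ.G i x k l = 0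
  K_pde : ∀ p q, ∀ x y h : ℝ, 0 ≤ h →
    (∀ s ∈ Icc 0 h, (x + S.speed i p * s, y + S.speed i q * s) ∈ triK) →
    κ.K i (x + S.speed i p * h) (y + S.speed i q * h) p q = κ.K i x y p q +
      ∫ s in (0 : ℝ)..h,
        (-(κ.K i (x + S.speed i p * s) (y + S.speed i q * s) * S.Sig i (y + S.speed i q * s)) +
          κ.Gfull i (x + S.speed i p * s) *
            κ.K i (x + S.speed i p * s) (y + S.speed i q * s)) p q
  K_diag : ∀ x ∈ Icc (0 : ℝ) 1,
    Matrix.diagonal (S.speed i) * κ.K i x x - κ.K i x x * Matrix.diagonal (S.speed i) =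
      S.Sig i x - κ.Gfull i x
  K_right : ∀ k l, ∀ x ∈ Icc (0 : ℝ) 1, (x < 1 ∨ k ≤ l) →
    ((κ.K i x 1).toBlocks₁₁ * Matrix.diagonal (S.lam i)) k l =
      ((κ.K i x 1).toBlocks₁₂ * Matrix.diagonal (S.mu i) * S.R i) k l
  F_pde : ∀ k l, ∀ x y h : ℝ, 0 ≤ h →
    (∀ s ∈ Icc 0 h, (x + S.lam i k * s, y + s) ∈ S.triF i) →
    κ.F i (x + S.lam i k * h) (y + h) k l = κ.F i x y k l +
      ∫ s in (0 : ℝ)..h, (κ.G i (x + S.lam i k * s) * κ.F i (x + S.lam i k * s) (y + s)) k l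
  F_bottom : ∀ x ∈ Icc (0 : ℝ) 1,
    κ.F i x 0 = -((κ.K i x 1).toBlocks₁₂ * Matrix.diagonal (S.mu i) * S.Rdown i)
  F_hyp : ∀ x ∈ Ioc (0 : ℝ) 1, ∀ (k : Fin (S.n i)) (l : Fin (S.m (i + 1))), 0 < k.val →
    κ.F i x (x / S.lam1 i) k l = 0

/-- The transformed rightward state `α_i(t,x)` (meaningful for `t ≥ 1 / λ_i^1`). -/
def Kernels.alpha {S : ChainSystem} (κ : S.Kernels) (u : (i : ℕ) → ℝ → ℝ → Fin (S.n i) → ℝ)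
    (v : (i : ℕ) → ℝ → ℝ → Fin (S.m i) → ℝ) (i : ℕ) (t x : ℝ) : Fin (S.n i) → ℝ :=
  u i t x + (∫ y in (0 : ℝ)..(x / S.lam1 i), κ.F i x y *ᵥ S.vNext v i (t - y)) +
    ∫ y in x..1, ((κ.K i x y).toBlocks₁₁ *ᵥ u i t y + (κ.K i x y).toBlocks₁₂ *ᵥ v i t y)

end ChainSystem

/-- The `τ`-delay operator. -/
def delayed {E : Type*} (τ : ℝ) (γ : ℝ → E) : ℝ → E := fun t => γ (t - τ)

/-- Continuous `ℝ^k`-valued signals, with locally uniform convergence. -/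
abbrev Signal (k : ℕ) : Type := C(ℝ, Fin k → ℝ)

/-- The values of the output signal at the times `t + ν`, `0 ≤ ν ≤ w`, are determined by the
measurement on `[0, t]`: the estimate is known at time `t` on the window `[t, t + w]`. -/
def CausalOnWindow {p q : ℕ} (A : Signal p → Signal q) (w : ℝ) : Prop :=
  ∀ t, 0 ≤ t → ∀ y y' : Signal p, (∀ s ∈ Icc 0 t, y s = y' s) →
    ∀ ν ∈ Icc 0 w, A y (t + ν) = A y' (t + ν)

/-- The output signals at time `s` only depend on the input signals up to time `s + h`. -/
def HasLookahead {p p' q q' : ℕ} (Φ : Signal p × Signal p' → Signal q × Signal q') (h : ℝ) :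
    Prop :=
  ∀ s, ∀ a a' : Signal p, ∀ b b' : Signal p', (∀ r ≤ s + h, a r = a' r ∧ b r = b' r) →
    (Φ (a, b)).1 s = (Φ (a', b')).1 s ∧ (Φ (a, b)).2 s = (Φ (a', b')).2 s

end

/-!
Exchange the roles of `x` and `t`.  Subsystem `i + 1` transports in the `x` direction with the
finite slownesses `1 / λ` and `-1 / μ`, so that its state at `x = 1`, given at all times, determines
its state at `x = 0` by a Volterra equation along the characteristics.  The Neumann series of the
Volterra operator converges locally uniformly because of the factorials from iterated integration.
As the characteristics through `(0, t)` meet `x = 1` within `[t - 1 / μ^1, t + 1 / λ^1]`, this looks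
ahead by `1 / λ^1` and delays exactness by `1 / μ^1`.

The boundary condition at `x = 0` and a left inverse of `Q_{i+1,i}` then give `u_i(·,1)`, and
`v_{i+1}(·,0)` is part of that state.  Together they determine `v_i(·,1)`, hence the state of
subsystem `i` at `x = 1`.  As the `K`-integral vanishes at `x = 1`, `α_i(·,1)` and `u_i(·,1)` differ
by a causal convolution of `v_{i+1}(·,0)` with `F_i(1, ·)`.  A delay `τ ≥ ∑ 1 / λ^1` of the
measurement compensates all the lookaheads.
-/

noncomputable section

open Filter Topology MeasureTheory intervalIntegral

section NeumannSeries

variable {E : Type*} [AddCommGroup E] [Module ℝ E] [TopologicalSpace E] [IsTopologicalAddGroup E]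
  [ContinuousSMul ℝ E] [BarrelledSpace ℝ E] [PolynormableSpace ℝ E] [T2Space E]

/-- The Neumann series `∑ T ^ k` of an operator on a barrelled space, for instance a Fréchet space,
on which it converges pointwise.  It is continuous by the Banach–Steinhaus theorem. -/
def neumannSeries (T : E →L[ℝ] E) (hT : ∀ x, Summable fun k : ℕ => (T ^ k) x) : E →L[ℝ] E :=
  letI : UniformSpace E := IsTopologicalAddGroup.rightUniformSpace E
  haveI : IsUniformAddGroup E := isUniformAddGroup_of_addCommGroup
  continuousLinearMapOfTendsto (l := atTop) (fun n => ∑ k ∈ Finset.range n, T ^ k)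
    (f := fun x => ∑' k : ℕ, (T ^ k) x) <| tendsto_pi_nhds.2 fun x => by
      simpa only [_root_.sum_apply] using (hT x).hasSum.tendsto_sum_nat

theorem neumannSeries_apply (T : E →L[ℝ] E) (hT : ∀ x, Summable fun k : ℕ => (T ^ k) x) (x : E) :
    neumannSeries T hT x = ∑' k : ℕ, (T ^ k) x :=
  rfl

theorem neumannSeries_sub_apply (T : E →L[ℝ] E) (hT : ∀ x, Summable fun k : ℕ => (T ^ k) x)
    (x : E) : neumannSeries T hT (x - T x) = x := by
  have hshift : neumannSeries T hT (T x) = ∑' k : ℕ, (T ^ (k + 1)) x :=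
    tsum_congr fun k => by rw [pow_succ, mul_apply_eq_comp]
  rw [map_sub, hshift, neumannSeries_apply, (hT x).tsum_eq_zero_add, add_sub_cancel_right, pow_zero,
    one_apply_eq_self]

end NeumannSeries

section Volterra

variable {ι : Type*} {d : ι → ℝ} {D : Set (ℝ × ℝ)}

/-- A set that contains, with each of its points, the characteristics from there to `ξ = 0`. -/
def CharClosed (d : ι → ℝ) (D : Set (ℝ × ℝ)) : Prop :=
  ∀ z ∈ D, ∀ p, ∀ η ∈ uIcc 0 z.1, (η, z.2 + d p * (z.1 - η)) ∈ D

/-- The operator that transports the component `p` of a signal with slowness `d p`, without any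
coupling. -/
def transport (d : ι → ℝ) : C(ℝ, ι → ℝ) →L[ℝ] C(ℝ × ℝ, ι → ℝ) where
  toFun g := ⟨fun z p => g (z.2 + d p * z.1) p, by fun_prop⟩
  map_add' _ _ := rfl
  map_smul' _ _ := rfl
  cont := ContinuousMap.continuous_of_continuous_uncurry _ <| continuous_pi fun p => by
    change Continuous fun x : C(ℝ, ι → ℝ) × ℝ × ℝ => x.1 (x.2.2 + d p * x.2.1) p
    fun_prop

theorem CharClosed.transport_eqOn (hD : CharClosed d D) {g g' : C(ℝ, ι → ℝ)}
    (h : ∀ s, (0, s) ∈ D → g s = g' s) : EqOn (transport d g) (transport d g') D := by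
  intro z hz
  ext p
  have hmem := hD z hz p 0 left_mem_uIcc
  rw [sub_zero] at hmem
  exact congrFun (h _ hmem) p

theorem charClosed_setOf_le_add {b : ℝ} (hb : ∀ p, d p ≤ b) (t₀ : ℝ) :
    CharClosed d {z | z.1 ∈ Icc 0 1 ∧ z.2 ≤ t₀ + b * (1 - z.1)} := by
  rintro ⟨ξ, t⟩ ⟨hξ, ht⟩ p η hη
  rw [uIcc_of_le hξ.1] at hη
  have hstep := mul_le_mul_of_nonneg_right (hb p) (sub_nonneg.2 hη.2)
  refine ⟨⟨hη.1, hη.2.trans hξ.2⟩, ?_⟩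
  dsimp only at ht ⊢
  linarith

theorem charClosed_setOf_add_le {a : ℝ} (ha : ∀ p, -a ≤ d p) (T : ℝ) :
    CharClosed d {z | z.1 ∈ Icc 0 1 ∧ T + a * z.1 ≤ z.2} := by
  rintro ⟨ξ, t⟩ ⟨hξ, ht⟩ p η hη
  rw [uIcc_of_le hξ.1] at hη
  have hstep := mul_le_mul_of_nonneg_right (ha p) (sub_nonneg.2 hη.2)
  refine ⟨⟨hη.1, hη.2.trans hξ.2⟩, ?_⟩
  dsimp only at ht ⊢
  linarith

theorem exists_charClosed_superset [Finite ι] (d : ι → ℝ) {K : Set (ℝ × ℝ)}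
    (hK : Bornology.IsBounded K) :
    ∃ D, K ⊆ D ∧ CharClosed d D ∧ Bornology.IsBounded D := by
  cases nonempty_fintype ι
  obtain ⟨r, hKr⟩ := hK.subset_closedBall 0
  refine ⟨{z | |z.1| ≤ r ∧ |z.2| ≤ r + ‖d‖ * (r - |z.1|)}, fun z hz => ?_, ?_, ?_⟩
  · obtain ⟨h1, h2⟩ := max_le_iff.1 (mem_closedBall_zero_iff.1 (hKr hz))
    refine ⟨h1, h2.trans (le_add_of_nonneg_right ?_)⟩
    exact mul_nonneg (norm_nonneg d) (sub_nonneg.2 h1)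
  · rintro ⟨ξ, t⟩ ⟨hξ, ht⟩ p η hη
    have hη' : |η| + |ξ - η| = |ξ| := by
      rcases mem_uIcc.1 hη with h | h
      · rw [abs_of_nonneg h.1, abs_of_nonneg (sub_nonneg.2 h.2), abs_of_nonneg (h.1.trans h.2)]
        ring
      · rw [abs_of_nonpos h.2, abs_of_nonpos (sub_nonpos.2 h.1), abs_of_nonpos (h.1.trans h.2)]
        ring
    refine ⟨(le_add_of_nonneg_right (abs_nonneg _)).trans (hη'.trans_le hξ), ?_⟩
    calc |t + d p * (ξ - η)| ≤ |t| + ‖d‖ * |ξ - η| := by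
          refine (abs_add_le _ _).trans ?_
          rw [abs_mul]
          gcongr
          exact norm_le_pi_norm d p
      _ ≤ r + ‖d‖ * (r - |η|) := by
          rw [eq_sub_of_add_eq' hη']
          linarith
  · refine isBounded_iff_forall_norm_le.2 ⟨r + ‖d‖ * r, fun z hz => ?_⟩
    have hr : 0 ≤ r := (abs_nonneg _).trans hz.1
    refine max_le (hz.1.trans (le_add_of_nonneg_right (by positivity))) (hz.2.trans ?_)
    gcongr
    exact sub_le_self _ (abs_nonneg _)

variable [Fintype ι]

/-- The Volterra operator that integrates `B w` along characteristics: the component `p` of the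
result at `(ξ, t)` is the integral along the line through `(ξ, t)` on which `t + d p * ξ` is
constant, from `ξ = 0` on. -/
def volterra (d : ι → ℝ) (B : C(ℝ, (ι → ℝ) →L[ℝ] (ι → ℝ))) :
    C(ℝ × ℝ, ι → ℝ) →L[ℝ] C(ℝ × ℝ, ι → ℝ) where
  toFun w :=
    { toFun := fun z p => ∫ η in (0 : ℝ)..z.1, B η (w (η, z.2 + d p * (z.1 - η))) p
      continuous_toFun := continuous_pi fun p =>
        continuous_parametric_intervalIntegral_of_continuous (by fun_prop) continuous_fst }
  map_add' w w' := by
    ext z p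
    simp only [ContinuousMap.coe_mk, ContinuousMap.add_apply, map_add, Pi.add_apply]
    exact integral_add (Continuous.intervalIntegrable (by fun_prop) _ _)
      (Continuous.intervalIntegrable (by fun_prop) _ _)
  map_smul' c w := by
    ext z p
    simp [intervalIntegral.integral_const_mul]
  cont := by
    refine ContinuousMap.continuous_of_continuous_uncurry _ (continuous_pi fun p => ?_)
    exact continuous_parametric_intervalIntegral_of_continuous
      (f := fun (x : C(ℝ × ℝ, ι → ℝ) × ℝ × ℝ) η => B η (x.1 (η, x.2.2 + d p * (x.2.1 - η))) p)
      (by fun_prop) (by fun_prop)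

variable {B : C(ℝ, (ι → ℝ) →L[ℝ] (ι → ℝ))}

theorem volterra_apply (w : C(ℝ × ℝ, ι → ℝ)) (z : ℝ × ℝ) (p : ι) :
    volterra d B w z p = ∫ η in (0 : ℝ)..z.1, B η (w (η, z.2 + d p * (z.1 - η))) p :=
  rfl

theorem CharClosed.norm_volterra_le (hD : CharClosed d D) {M c : ℝ}
    (hM : ∀ z ∈ D, ‖B z.1‖ ≤ M) {w : C(ℝ × ℝ, ι → ℝ)} {k : ℕ}
    (hw : ∀ z ∈ D, ‖w z‖ ≤ c * |z.1| ^ k) {z : ℝ × ℝ} (hz : z ∈ D) :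
    ‖volterra d B w z‖ ≤ M * c / (k + 1) * |z.1| ^ (k + 1) := by
  have hM0 : 0 ≤ M := (norm_nonneg _).trans (hM z hz)
  have hle : ∀ p, ∀ η ∈ uIoc 0 z.1, ‖B η (w (η, z.2 + d p * (z.1 - η))) p‖ ≤
      M * (c * |η| ^ k) := fun p η hη => by
    have hmem := hD z hz p η (uIoc_subset_uIcc hη)
    calc ‖B η (w (η, z.2 + d p * (z.1 - η))) p‖
      _ ≤ ‖B η (w (η, z.2 + d p * (z.1 - η)))‖ := norm_le_pi_norm _ p
      _ ≤ ‖B η‖ * ‖w (η, z.2 + d p * (z.1 - η))‖ := (B η).le_opNorm _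
      _ ≤ M * (c * |η| ^ k) := mul_le_mul (hM (η, _) hmem) (hw (η, _) hmem) (norm_nonneg _) hM0
  have hnonneg : 0 ≤ M * c / (k + 1) * |z.1| ^ (k + 1) := by
    calc 0 ≤ M * (c * |z.1| ^ k) * (|z.1| / (k + 1)) :=
          mul_nonneg (mul_nonneg hM0 ((norm_nonneg _).trans (hw z hz))) (by positivity)
      _ = M * c / (k + 1) * |z.1| ^ (k + 1) := by ring
  refine (pi_norm_le_iff_of_nonneg hnonneg).2 fun p => ?_
  calc ‖volterra d B w z p‖
    _ = ‖∫ η in uIoc 0 z.1, B η (w (η, z.2 + d p * (z.1 - η))) p‖ :=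
      norm_integral_eq_norm_integral_uIoc _
    _ ≤ ∫ η in uIoc 0 z.1, M * (c * |η| ^ k) :=
      MeasureTheory.norm_integral_le_of_norm_le (Continuous.integrableOn_uIoc (by fun_prop))
        ((ae_restrict_iff' measurableSet_uIoc).2 (.of_forall (hle p)))
    _ = M * c * ∫ η in uIoc 0 z.1, |η - 0| ^ k := by
      simp only [sub_zero, ← mul_assoc, MeasureTheory.integral_const_mul]
    _ = M * c / (k + 1) * |z.1| ^ (k + 1) := by
      rw [integral_pow_abs_sub_uIoc, sub_zero]
      ring

theorem CharClosed.norm_volterra_pow_le (hD : CharClosed d D) {M C : ℝ}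
    (hM : ∀ z ∈ D, ‖B z.1‖ ≤ M) {w : C(ℝ × ℝ, ι → ℝ)} (hw : ∀ z ∈ D, ‖w z‖ ≤ C) (k : ℕ) :
    ∀ z ∈ D, ‖(volterra d B ^ k) w z‖ ≤ C * M ^ k / k.factorial * |z.1| ^ k := by
  induction k with
  | zero => simpa using hw
  | succ k ih =>
    intro z hz
    rw [pow_succ', mul_apply_eq_comp]
    refine (hD.norm_volterra_le hM ih hz).trans_eq ?_
    rw [Nat.factorial_succ]
    push_cast
    field_simp
    ring

theorem summable_volterra_pow (d : ι → ℝ) (B : C(ℝ, (ι → ℝ) →L[ℝ] (ι → ℝ)))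
    (w : C(ℝ × ℝ, ι → ℝ)) : Summable fun k : ℕ => (volterra d B ^ k) w := by
  refine ContinuousMap.summable_of_locally_summable_norm fun K => ?_
  obtain ⟨D, hKD, hD, hbdd⟩ := exists_charClosed_superset d K.isCompact.isBounded
  obtain ⟨r, hr⟩ := hbdd.subset_closedBall 0
  obtain ⟨M, hM⟩ := hbdd.isCompact_closure.exists_bound_of_continuousOn
    (f := fun z => B z.1) (by fun_prop)
  obtain ⟨C, hC⟩ := hbdd.isCompact_closure.exists_bound_of_continuousOn
    w.continuous.continuousOn
  have hpow : ∀ k, ∀ z ∈ D, ‖(volterra d B ^ k) w z‖ ≤ |C| * ((|M| * |r|) ^ k / k.factorial) :=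
    fun k z hz => by
      have hz1 : |z.1| ≤ |r| := (norm_fst_le z).trans
        ((mem_closedBall_zero_iff.1 (hr hz)).trans (le_abs_self r))
      refine (hD.norm_volterra_pow_le (M := |M|) (C := |C|)
        (fun z hz => (hM z (subset_closure hz)).trans (le_abs_self M))
        (fun z hz => (hC z (subset_closure hz)).trans (le_abs_self C)) k z hz).trans ?_
      rw [mul_div_assoc, mul_assoc, div_mul_eq_mul_div, ← mul_pow]
      gcongr
  exact Summable.of_nonneg_of_le (fun _ => norm_nonneg _)
    (fun k => (ContinuousMap.norm_le _ (by positivity)).2 fun z => hpow k z (hKD z.2))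
    ((Real.summable_pow_div_factorial (|M| * |r|)).mul_left |C|)

theorem CharClosed.volterra_pow_eqOn_zero (hD : CharClosed d D) {w : C(ℝ × ℝ, ι → ℝ)}
    (hw : EqOn w 0 D) (k : ℕ) : EqOn ((volterra d B ^ k) w) 0 D := by
  induction k with
  | zero => exact hw
  | succ k ih =>
    intro z hz
    ext p
    rw [pow_succ', mul_apply_eq_comp, volterra_apply]
    refine integral_zero_ae <| .of_forall fun η hη => ?_
    rw [ih (hD z hz p η (uIoc_subset_uIcc hη)), Pi.zero_apply, map_zero, Pi.zero_apply]

/-- The solution operator `f ↦ w` of the Volterra equation `w = f + volterra d B w`. -/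
def volterraResolvent (d : ι → ℝ) (B : C(ℝ, (ι → ℝ) →L[ℝ] (ι → ℝ))) :
    C(ℝ × ℝ, ι → ℝ) →L[ℝ] C(ℝ × ℝ, ι → ℝ) :=
  neumannSeries (volterra d B) (summable_volterra_pow d B)

theorem CharClosed.volterraResolvent_eqOn (hD : CharClosed d D) {f f' : C(ℝ × ℝ, ι → ℝ)}
    (h : EqOn f f' D) : EqOn (volterraResolvent d B f) (volterraResolvent d B f') D := by
  intro z hz
  have hzero : EqOn (f - f') 0 D := fun z hz => sub_eq_zero.2 (h hz)
  have hsum := summable_volterra_pow d B (f - f')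
  rw [← sub_eq_zero, ← ContinuousMap.sub_apply, ← map_sub, volterraResolvent, neumannSeries_apply,
    ← ContinuousMap.tsum_apply hsum]
  exact (tsum_congr fun k => hD.volterra_pow_eqOn_zero hzero k hz).trans tsum_zero

/-- The operator that maps the state at `ξ = 0`, as a signal in `t`, to the state at `ξ = 1` of the
solution of `∂_ξ w_p - d_p ∂_t w_p = (B(ξ) w)_p`. -/
def charFlow (d : ι → ℝ) (B : C(ℝ, (ι → ℝ) →L[ℝ] (ι → ℝ))) :
    C(ℝ, ι → ℝ) →L[ℝ] C(ℝ, ι → ℝ) where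
  toFun g := (volterraResolvent d B (transport d g)).comp ⟨fun t => (1, t), by fun_prop⟩
  map_add' _ _ := by simp only [map_add]; rfl
  map_smul' _ _ := by simp only [map_smul]; rfl
  cont := (ContinuousMap.continuous_precomp ⟨fun t => ((1 : ℝ), t), by fun_prop⟩).comp
    (volterraResolvent d B ∘L transport d).continuous

theorem CharClosed.charFlow_congr (hD : CharClosed d D) {g g' : C(ℝ, ι → ℝ)}
    (h : ∀ s, (0, s) ∈ D → g s = g' s) {t : ℝ} (ht : (1, t) ∈ D) :
    charFlow d B g t = charFlow d B g' t :=
  hD.volterraResolvent_eqOn (hD.transport_eqOn h) ht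

theorem CharClosed.charFlow_eq (hD : CharClosed d D) {w : C(ℝ × ℝ, ι → ℝ)} {g : C(ℝ, ι → ℝ)}
    (hg : ∀ s, (0, s) ∈ D → g s = w (0, s))
    (hw : ∀ z ∈ D, ∀ p, w z p = w (0, z.2 + d p * z.1) p + volterra d B w z p) {t : ℝ}
    (ht : (1, t) ∈ D) : charFlow d B g t = w (1, t) := by
  have hsource : EqOn (transport d g) (w - volterra d B w) D := fun z hz => by
    ext p
    have hmem := hD z hz p 0 left_mem_uIcc
    rw [sub_zero] at hmem
    calc transport d g z p = w (0, z.2 + d p * z.1) p := congrFun (hg _ hmem) p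
      _ = (w - volterra d B w) z p := by
        rw [ContinuousMap.sub_apply, Pi.sub_apply, hw z hz p, add_sub_cancel_right]
  calc charFlow d B g t = volterraResolvent d B (w - volterra d B w) (1, t) :=
      hD.volterraResolvent_eqOn hsource ht
    _ = w (1, t) := by rw [volterraResolvent, neumannSeries_sub_apply]

theorem charFlow_congr_of_le {b : ℝ} (hb : ∀ p, d p ≤ b) {g g' : C(ℝ, ι → ℝ)} {t : ℝ}
    (h : ∀ s ≤ t + b, g s = g' s) : charFlow d B g t = charFlow d B g' t :=
  (charClosed_setOf_le_add hb t).charFlow_congr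
    (fun s hs => h s (by simpa using hs.2)) ⟨right_mem_Icc.2 zero_le_one, by simp⟩

end Volterra

section Convolution

variable {E F : Type*} [NormedAddCommGroup E] [NormedSpace ℝ E] [NormedAddCommGroup F]
  [NormedSpace ℝ F] {H : ℝ → E →L[ℝ] F} {c : ℝ}

theorem intervalIntegrable_clm_apply (hH : IntervalIntegrable H volume 0 c) {f : ℝ → E}
    (hf : Continuous f) : IntervalIntegrable (fun y => H y (f y)) volume 0 c := by
  obtain ⟨C, hC⟩ := isCompact_uIcc.exists_bound_of_continuousOn hf.continuousOn
  refine (hH.norm.mul_const C).mono_fun' ?_ ?_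
  · exact (ContinuousLinearMap.id ℝ (E →L[ℝ] F)).aestronglyMeasurable_comp₂
      hH.def'.aestronglyMeasurable hf.aestronglyMeasurable
  · refine (ae_restrict_iff' measurableSet_uIoc).2 (.of_forall fun y hy => ?_)
    exact (H y).le_opNorm_of_le (hC y (uIoc_subset_uIcc hy))

theorem continuous_integral_clm_apply_sub (hH : IntervalIntegrable H volume 0 c) :
    Continuous fun z : C(ℝ, E) × ℝ => ∫ y in (0 : ℝ)..c, H y (z.1 (z.2 - y)) := by
  refine continuous_iff_continuousAt.2 fun z₀ => ?_
  obtain ⟨C, hC⟩ := (isCompact_uIcc (a := 0) (b := c)).exists_bound_of_continuousOn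
    (f := fun y => z₀.1 (z₀.2 - y)) (by fun_prop)
  have hbound : ∀ᶠ z : C(ℝ, E) × ℝ in 𝓝 z₀, ∀ y ∈ uIcc 0 c, ‖z.1 (z.2 - y)‖ < C + 1 := by
    refine isCompact_uIcc.eventually_forall_of_forall_eventually fun y hy => ?_
    have hcont : Continuous fun x : (C(ℝ, E) × ℝ) × ℝ => ‖x.1.1 (x.1.2 - x.2)‖ := by fun_prop
    exact hcont.continuousAt.eventually_lt_const ((hC y hy).trans_lt (lt_add_one C))
  refine continuousAt_of_dominated_interval (bound := fun y => ‖H y‖ * (C + 1))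
    (.of_forall fun z => ?_) ?_ (hH.norm.mul_const _) (.of_forall fun y _ => ?_)
  · exact (intervalIntegrable_clm_apply hH (by fun_prop)).def'.aestronglyMeasurable
  · filter_upwards [hbound] with z hz
    exact .of_forall fun y hy => (H y).le_opNorm_of_le (hz y (uIoc_subset_uIcc hy)).le
  · exact Continuous.continuousAt (by fun_prop)

/-- The convolution of signals with an operator-valued kernel on `[0, c]`. -/
def convolution (hH : IntervalIntegrable H volume 0 c) : C(ℝ, E) →L[ℝ] C(ℝ, F) where
  toFun b := ⟨fun t => ∫ y in (0 : ℝ)..c, H y (b (t - y)),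
    (continuous_integral_clm_apply_sub hH).comp (Continuous.prodMk_right b)⟩
  map_add' b b' := by
    ext t
    simp only [ContinuousMap.coe_mk, ContinuousMap.add_apply, map_add]
    exact integral_add (intervalIntegrable_clm_apply hH (by fun_prop))
      (intervalIntegrable_clm_apply hH (by fun_prop))
  map_smul' a b := by
    ext t
    simp
  cont := ContinuousMap.continuous_of_continuous_uncurry _ (continuous_integral_clm_apply_sub hH)

theorem convolution_apply (hH : IntervalIntegrable H volume 0 c) (b : C(ℝ, E)) (t : ℝ) :
    convolution hH b t = ∫ y in (0 : ℝ)..c, H y (b (t - y)) :=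
  rfl

theorem convolution_congr (hH : IntervalIntegrable H volume 0 c) (hc : 0 ≤ c) {b b' : C(ℝ, E)}
    {t : ℝ} (h : ∀ r ≤ t, b r = b' r) : convolution hH b t = convolution hH b' t := by
  refine integral_congr fun y hy => ?_
  rw [uIcc_of_le hc] at hy
  simp only [h (t - y) (sub_le_self t hy.1)]

end Convolution

section Matrix

variable {m n : Type*} [Fintype n] [DecidableEq n]

/-- The action of matrices on vectors, as continuous linear operators. -/
def mulVecL : Matrix m n ℝ →ₗ[ℝ] (n → ℝ) →L[ℝ] (m → ℝ) :=
  LinearMap.toContinuousLinearMap.toLinearMap ∘ₗ Matrix.toLin'.toLinearMap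

theorem continuous_mulVecL [Finite m] :
    Continuous (mulVecL : Matrix m n ℝ →ₗ[ℝ] (n → ℝ) →L[ℝ] (m → ℝ)) :=
  LinearMap.continuous_of_finiteDimensional _

theorem intervalIntegrable_mulVecL [Fintype m] {H : ℝ → Matrix m n ℝ} {a b : ℝ}
    (hH : ∀ k l, IntervalIntegrable (fun y => H y k l) volume a b) :
    IntervalIntegrable (fun y => mulVecL (H y)) volume a b := by
  let L : (m → n → ℝ) →ₗ[ℝ] (n → ℝ) →L[ℝ] (m → ℝ) :=
    mulVecL ∘ₗ (Matrix.ofLinearEquiv ℝ).toLinearMap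
  simp only [intervalIntegrable_iff] at hH ⊢
  exact L.toContinuousLinearMap.integrable_comp (.of_eval fun k => .of_eval (hH k))

end Matrix

theorem PiecewiseContinuousOn.intervalIntegrable {f : ℝ × ℝ → ℝ} {D : Set (ℝ × ℝ)}
    (hf : PiecewiseContinuousOn f D) {x a b : ℝ} (hD : ∀ y ∈ uIcc a b, (x, y) ∈ D) :
    IntervalIntegrable (fun y => f (x, y)) volume a b := by
  obtain ⟨r, P, g, hP, hg, hcover, hfg⟩ := hf
  have hsub : uIcc a b ⊆ ⋃ j, uIcc a b ∩ Prod.mk x ⁻¹' P j := fun y hy => by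
    obtain ⟨j, hj⟩ := mem_iUnion.1 (hcover (hD y hy))
    exact mem_iUnion.2 ⟨j, hy, hj⟩
  refine IntegrableOn.intervalIntegrable
    (IntegrableOn.mono_set (integrableOn_finite_iUnion.2 fun j => ?_) hsub)
  have hslice : Convex ℝ (Prod.mk x ⁻¹' P j) := fun y hy z hz s t hs ht hst => by
    simpa [← add_mul, hst] using hP j hy hz hs ht hst
  have hgj : Continuous fun y => g j (x, y) := (hg j).comp (by fun_prop)
  exact (hgj.integrableOn_uIcc.mono_set inter_subset_left).congr_fun
    (fun y hy => (hfg j (x, y) ⟨hD y hy.1, hy.2⟩).symm)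
    (measurableSet_uIcc.inter hslice.ordConnected.measurableSet)

namespace ChainSystem

variable (S : ChainSystem)

/-- The derivatives `dt/dx` of the characteristics of subsystem `i`, that is, the slownesses in the
coordinate `ξ = 1 - x`. -/
def slope (i : ℕ) (p : S.Idx i) : ℝ := 1 / S.speed i p

variable {S} {i : ℕ}

theorem lam1_pos (hi : i ∈ Icc 1 S.N) : 0 < S.lam1 i := S.lam_pos i hi.1 hi.2 _

theorem mu1_pos (hi : i ∈ Icc 1 S.N) : 0 < S.mu1 i := S.mu_pos i hi.1 hi.2 _

theorem slope_le (hi : i ∈ Icc 1 S.N) (p : S.Idx i) : S.slope i p ≤ 1 / S.lam1 i := by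
  cases p with
  | inl k =>
    exact one_div_le_one_div_of_le (lam1_pos hi)
      ((S.lam_strictMono i hi.1 hi.2).monotone (Fin.mk_le_of_le_val (Nat.zero_le _)))
  | inr k =>
    refine le_trans (one_div_nonpos.2 ?_) (one_div_nonneg.2 (lam1_pos hi).le)
    exact neg_nonpos.2 (S.mu_pos i hi.1 hi.2 k).le

theorem neg_le_slope (hi : i ∈ Icc 1 S.N) (p : S.Idx i) : -(1 / S.mu1 i) ≤ S.slope i p := by
  cases p with
  | inl k =>
    refine le_trans (neg_nonpos.2 (one_div_nonneg.2 (mu1_pos hi).le)) (one_div_nonneg.2 ?_)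
    exact (S.lam_pos i hi.1 hi.2 k).le
  | inr k =>
    change _ ≤ 1 / -S.mu i k
    rw [one_div_neg_eq_neg_one_div]
    exact neg_le_neg (one_div_le_one_div_of_le (mu1_pos hi)
      ((S.mu_strictMono i hi.1 hi.2).monotone (Fin.mk_le_of_le_val (Nat.zero_le _))))

theorem speed_ne_zero (hi : i ∈ Icc 1 S.N) (p : S.Idx i) : S.speed i p ≠ 0 := by
  cases p with
  | inl k => exact (S.lam_pos i hi.1 hi.2 k).ne'
  | inr k => exact neg_ne_zero.2 (S.mu_pos i hi.1 hi.2 k).ne'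

theorem continuousOn_Sig (hi : i ∈ Icc 1 S.N) : ContinuousOn (S.Sig i) (Icc 0 1) := by
  rw [continuousOn_iff_continuous_domRestrict]
  exact (S.Spp_cont i hi.1 hi.2).domRestrict.matrix_fromBlocks
    (S.Spm_cont i hi.1 hi.2).domRestrict (S.Smp_cont i hi.1 hi.2).domRestrict
    (S.Smm_cont i hi.1 hi.2).domRestrict

/-- The operators `B(ξ) = -Λ_i⁻¹ Σ_i(1 - ξ)` that couple the states of subsystem `i` in the
coordinate `ξ = 1 - x`, extended to all `ξ` by their values at `ξ = 0` and `ξ = 1`. -/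
def coupling (hi : i ∈ Icc 1 S.N) : C(ℝ, (S.Idx i → ℝ) →L[ℝ] (S.Idx i → ℝ)) where
  toFun ξ := mulVecL (Matrix.diagonal (-S.slope i) * S.Sig i (projIcc 0 1 zero_le_one (1 - ξ)))
  continuous_toFun := by
    have hSig : Continuous fun ξ : ℝ => S.Sig i (projIcc (0 : ℝ) 1 zero_le_one (1 - ξ)) :=
      (continuousOn_Sig hi).comp_continuous (by fun_prop) fun _ => Subtype.prop _
    exact continuous_mulVecL.comp (continuous_const.matrix_mul hSig)

theorem coupling_apply (hi : i ∈ Icc 1 S.N) {ξ : ℝ} (hξ : ξ ∈ Icc (0 : ℝ) 1) (w : S.Idx i → ℝ)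
    (p : S.Idx i) : coupling hi ξ w p = -S.slope i p * (S.Sig i (1 - ξ) *ᵥ w) p := by
  have hproj : (projIcc (0 : ℝ) 1 zero_le_one (1 - ξ) : ℝ) = 1 - ξ := by
    rw [projIcc_of_mem _ ⟨sub_nonneg.2 hξ.2, sub_le_self _ hξ.1⟩]
  change ((Matrix.diagonal (-S.slope i) * S.Sig i _) *ᵥ w) p = _
  rw [hproj, ← Matrix.mulVec_mulVec, Matrix.mulVec_diagonal, Pi.neg_apply]

namespace IsSolution

variable {U : ℝ → Fin (S.n 1) → ℝ} {u : (i : ℕ) → ℝ → ℝ → Fin (S.n i) → ℝ}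
  {v : (i : ℕ) → ℝ → ℝ → Fin (S.m i) → ℝ}

theorem hasDerivAt_state (hs : S.IsSolution U u v) (hi : i ∈ Icc 1 S.N) {t x : ℝ} (ht : 0 < t)
    (hx : x ∈ Ioo (0 : ℝ) 1) (p : S.Idx i) :
    HasDerivAt (fun r => Sum.elim (u i (t + r) (x + S.speed i p * r))
        (v i (t + r) (x + S.speed i p * r)) p)
      ((S.Sig i x *ᵥ Sum.elim (u i t x) (v i t x)) p) 0 := by
  rw [Sig, Matrix.fromBlocks_mulVec]
  cases p with
  | inl k => exact hs.pde_u i hi.1 hi.2 t ht x hx k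
  | inr k =>
    have h := hs.pde_v i hi.1 hi.2 t ht x hx k
    simp only [sub_eq_add_neg, ← neg_mul] at h
    exact h

/-- The state of subsystem `i`, delayed by `τ`, in the coordinates `(ξ, t) = (1 - x, t)`.  Outside
`0 ≤ ξ ≤ 1`, `τ ≤ t` it takes the value at the closest point of that domain. -/
def reflectedState (hs : S.IsSolution U u v) (hi : i ∈ Icc 1 S.N) (τ : ℝ) :
    C(ℝ × ℝ, S.Idx i → ℝ) where
  toFun z := Sum.elim (u i (max (z.2 - τ) 0) (projIcc (0 : ℝ) 1 zero_le_one (1 - z.1)))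
    (v i (max (z.2 - τ) 0) (projIcc (0 : ℝ) 1 zero_le_one (1 - z.1)))
  continuous_toFun := by
    have hclamp : Continuous fun z : ℝ × ℝ =>
        (max (z.2 - τ) 0, (projIcc (0 : ℝ) 1 zero_le_one (1 - z.1) : ℝ)) := by fun_prop
    have hmem : ∀ z : ℝ × ℝ, (max (z.2 - τ) 0, (projIcc (0 : ℝ) 1 zero_le_one (1 - z.1) : ℝ)) ∈
        Ici 0 ×ˢ Icc 0 1 := fun z => ⟨mem_Ici.2 (le_max_right _ _), Subtype.prop _⟩
    refine continuous_pi fun p => ?_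
    cases p with
    | inl k =>
      exact (continuous_apply k).comp ((hs.cont_u i hi.1 hi.2).comp_continuous hclamp hmem)
    | inr k =>
      exact (continuous_apply k).comp ((hs.cont_v i hi.1 hi.2).comp_continuous hclamp hmem)

theorem reflectedState_apply (hs : S.IsSolution U u v) (hi : i ∈ Icc 1 S.N) {τ : ℝ} {z : ℝ × ℝ}
    (hξ : z.1 ∈ Icc (0 : ℝ) 1) (ht : τ ≤ z.2) :
    hs.reflectedState hi τ z = Sum.elim (u i (z.2 - τ) (1 - z.1)) (v i (z.2 - τ) (1 - z.1)) := by
  have hproj : (projIcc (0 : ℝ) 1 zero_le_one (1 - z.1) : ℝ) = 1 - z.1 := by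
    rw [projIcc_of_mem _ ⟨sub_nonneg.2 hξ.2, sub_le_self _ hξ.1⟩]
  change Sum.elim (u i (max (z.2 - τ) 0) _) (v i (max (z.2 - τ) 0) _) = _
  rw [hproj, max_eq_left (sub_nonneg.2 ht)]

theorem hasDerivAt_characteristic (hs : S.IsSolution U u v) (hi : i ∈ Icc 1 S.N) (p : S.Idx i)
    {c η : ℝ} (hη : η ∈ Ioo (0 : ℝ) 1) (hpos : 0 < c - S.slope i p * η) :
    HasDerivAt (fun r => Sum.elim (u i (c - S.slope i p * r) (1 - r))
        (v i (c - S.slope i p * r) (1 - r)) p)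
      (coupling hi η (Sum.elim (u i (c - S.slope i p * η) (1 - η))
        (v i (c - S.slope i p * η) (1 - η))) p) η := by
  have hslope : S.speed i p * S.slope i p = 1 := mul_one_div_cancel (speed_ne_zero hi p)
  have hstate := hs.hasDerivAt_state hi hpos ⟨sub_pos.2 hη.2, sub_lt_self _ hη.1⟩ p
  have hline : HasDerivAt (fun r => -S.slope i p * (r - η)) (-S.slope i p) η := by
    simpa using ((hasDerivAt_id η).sub_const η).const_mul (-S.slope i p)
  rw [coupling_apply hi (Ioo_subset_Icc_self hη), mul_comm]
  refine (HasDerivAt.comp η (by simpa using hstate) hline).congr_of_eventuallyEq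
    (.of_forall fun r => ?_)
  have htime : c - S.slope i p * η + -S.slope i p * (r - η) = c - S.slope i p * r := by ring
  have hspace : 1 - η + S.speed i p * (-S.slope i p * (r - η)) = 1 - r := by
    linear_combination (η - r) * hslope
  simp only [Function.comp_apply, htime, hspace]

theorem reflectedState_eq_add_volterra (hs : S.IsSolution U u v) (hi : i ∈ Icc 1 S.N) {τ : ℝ}
    {z : ℝ × ℝ} (hξ : z.1 ∈ Icc (0 : ℝ) 1) (p : S.Idx i)
    (ht : ∀ η ∈ Icc 0 z.1, τ ≤ z.2 + S.slope i p * (z.1 - η)) :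
    hs.reflectedState hi τ z p = hs.reflectedState hi τ (0, z.2 + S.slope i p * z.1) p +
      volterra (S.slope i) (coupling hi) (hs.reflectedState hi τ) z p := by
  have hne : S.slope i p ≠ 0 := one_div_ne_zero (speed_ne_zero hi p)
  set W := hs.reflectedState hi τ with hW
  set d := S.slope i p
  have hpos : ∀ η ∈ Ioo 0 z.1, 0 < z.2 + d * z.1 - τ - d * η := fun η hη => by
    have hleft := ht 0 (left_mem_Icc.2 hξ.1)
    have hright := ht z.1 (right_mem_Icc.2 hξ.1)
    rcases hne.lt_or_gt with h | h
    · nlinarith [mul_pos_of_neg_of_neg h (neg_lt_zero.2 hη.1)]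
    · nlinarith [mul_pos h (sub_pos.2 hη.2)]
  have hderiv : ∀ η ∈ Ioo 0 z.1, HasDerivAt (fun r => W (r, z.2 + d * (z.1 - r)) p)
      (coupling hi η (W (η, z.2 + d * (z.1 - η))) p) η := fun η hη => by
    have hW_apply : ∀ r ∈ Ioo 0 z.1, W (r, z.2 + d * (z.1 - r)) =
        Sum.elim (u i (z.2 + d * z.1 - τ - d * r) (1 - r))
          (v i (z.2 + d * z.1 - τ - d * r) (1 - r)) := fun r hr => by
      have htime : z.2 + d * (z.1 - r) - τ = z.2 + d * z.1 - τ - d * r := by ring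
      rw [hW, hs.reflectedState_apply hi ⟨hr.1.le, hr.2.le.trans hξ.2⟩
        (ht r (Ioo_subset_Icc_self hr)), htime]
    rw [hW_apply η hη]
    refine (hs.hasDerivAt_characteristic hi p ⟨hη.1, hη.2.trans_le hξ.2⟩
      (hpos η hη)).congr_of_eventuallyEq ?_
    filter_upwards [Ioo_mem_nhds hη.1 hη.2] with r hr
    rw [hW_apply r hr]
  rw [volterra_apply, integral_eq_sub_of_hasDerivAt_of_le hξ.1 (by fun_prop) hderiv
    (Continuous.intervalIntegrable (by fun_prop) _ _)]
  simp

/-- Exactness is delayed by `1 / μ_i^1` since the boundary data at `x = 1` have to reach `x = 0`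
along the slowest leftward characteristic. -/
theorem charFlow_eq (hs : S.IsSolution U u v) (hi : i ∈ Icc 1 S.N) {τ T : ℝ} (hT : τ ≤ T)
    {g : C(ℝ, S.Idx i → ℝ)}
    (hg : ∀ s, T ≤ s → g s = Sum.elim (u i (s - τ) 1) (v i (s - τ) 1))
    {s : ℝ} (hsT : T + 1 / S.mu1 i ≤ s) :
    charFlow (S.slope i) (coupling hi) g s = Sum.elim (u i (s - τ) 0) (v i (s - τ) 0) := by
  have hD := charClosed_setOf_add_le (neg_le_slope hi) T
  have hpos : 0 < 1 / S.mu1 i := one_div_pos.2 (mu1_pos hi)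
  have htime : ∀ z ∈ {z : ℝ × ℝ | z.1 ∈ Icc 0 1 ∧ T + 1 / S.mu1 i * z.1 ≤ z.2}, τ ≤ z.2 :=
    fun z hz => hT.trans <| (le_add_of_nonneg_right (mul_nonneg hpos.le hz.1.1)).trans hz.2
  rw [hD.charFlow_eq (w := hs.reflectedState hi τ) (fun r hr => ?_) (fun z hz p => ?_)
    ⟨right_mem_Icc.2 zero_le_one, by simpa using hsT⟩,
    hs.reflectedState_apply hi (right_mem_Icc.2 zero_le_one), sub_self]
  · exact hT.trans <| (le_add_of_nonneg_right hpos.le).trans hsT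
  · rw [hs.reflectedState_apply hi hr.1 (htime _ hr), hg r (by simpa using hr.2), sub_zero]
  · refine hs.reflectedState_eq_add_volterra hi hz.1 p fun η hη => htime _ (hD z hz p η ?_)
    rwa [uIcc_of_le hz.1.1]

end IsSolution

end ChainSystem

theorem ChainSystem.Kernels.IsBackstepping.intervalIntegrable_F {S : ChainSystem} {κ : S.Kernels}
    {i : ℕ} (hκ : κ.IsBackstepping i) (hi : i ∈ Icc 1 S.N) (k : Fin (S.n i))
    (l : Fin (S.m (i + 1))) :
    IntervalIntegrable (fun y => κ.F i 1 y k l) volume 0 (1 / S.lam1 i) :=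
  (hκ.pc_F k l).intervalIntegrable fun y hy => by
    rw [uIcc_of_le (one_div_nonneg.2 (lam1_pos hi).le)] at hy
    exact ⟨right_mem_Icc.2 zero_le_one, hy⟩

theorem exists_leftInverse_of_rank_eq_card {m n K : Type*} [Fintype m] [Fintype n] [DecidableEq n]
    [Field K] {M : Matrix m n K} (h : M.rank = Fintype.card n) : ∃ L : Matrix n m K, L * M = 1 := by
  have hrange : LinearMap.range Mᵀ.mulVecLin = ⊤ := Submodule.eq_top_of_finrank_eq <| by
    rw [Module.finrank_fintype_fun_eq_card, ← h, ← M.rank_transpose, Matrix.rank]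
  refine Matrix.vecMul_surjective_iff_exists_left_inverse.1 fun w => ?_
  obtain ⟨x, rfl⟩ := LinearMap.range_eq_top.1 hrange w
  exact ⟨x, (Matrix.mulVec_transpose M x).symm⟩

/-- The pointwise action of a matrix on signals. -/
def signalMul {m n : Type*} [Fintype n] [DecidableEq n] (M : Matrix m n ℝ) :
    C(ℝ, n → ℝ) →L[ℝ] C(ℝ, m → ℝ) :=
  (mulVecL M).compLeftContinuous ℝ ℝ

/-- Causality of an operator on signals: the output up to time `t` is determined by the input up to
time `t`. -/
def IsCausal {p q : ℕ} (J : Signal p → Signal q) : Prop :=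
  ∀ t, ∀ b b' : Signal p, (∀ r ≤ t, b r = b' r) → J b t = J b' t

namespace ChainSystem

variable {S : ChainSystem} {i : ℕ}

/-- The state `(u_i, v_i)` at `x = 1` in terms of `a = u_i(·,1) + J b` and `b = v_{i+1}(·,0)`; in
the application, `J b` is the integral of `F_i(1, ·)` against `b`, so that `a = α_i(·,1)`. -/
def outletState (J : Signal (S.m (i + 1)) →L[ℝ] Signal (S.n i)) :
    Signal (S.n i) × Signal (S.m (i + 1)) →L[ℝ] C(ℝ, S.Idx i → ℝ) :=
  signalMul (Matrix.fromRows 1 (S.R i)) ∘L (.fst ℝ _ _ - J ∘L .snd ℝ _ _) +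
    signalMul (Matrix.fromRows 0 (S.Rdown i)) ∘L .snd ℝ _ _

theorem outletState_apply (J : Signal (S.m (i + 1)) →L[ℝ] Signal (S.n i))
    (z : Signal (S.n i) × Signal (S.m (i + 1))) (t : ℝ) :
    outletState J z t = Sum.elim (z.1 t - J z.2 t)
      (S.R i *ᵥ (z.1 t - J z.2 t) + S.Rdown i *ᵥ z.2 t) := by
  change Matrix.fromRows 1 (S.R i) *ᵥ (z.1 t - J z.2 t) +
    Matrix.fromRows 0 (S.Rdown i) *ᵥ z.2 t = _
  rw [Matrix.fromRows_mulVec, Matrix.fromRows_mulVec, ← Sum.elim_add_add, Matrix.one_mulVec,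
    Matrix.zero_mulVec, add_zero]

/-- The signals `a = u_i(·,1) + J b` and `b = v_{i+1}(·,0)` in terms of the state of subsystem
`i + 1` at `x = 0` and a left inverse `L` of `Q_{i+1,i}`. -/
def upstreamSignals (J : Signal (S.m (i + 1)) →L[ℝ] Signal (S.n i))
    (L : Matrix (Fin (S.n i)) (Fin (S.n (i + 1))) ℝ) :
    C(ℝ, S.Idx (i + 1) → ℝ) →L[ℝ] Signal (S.n i) × Signal (S.m (i + 1)) :=
  (signalMul (L * Matrix.fromCols 1 (-S.Q (i + 1))) + J ∘L signalMul (Matrix.fromCols 0 1)).prod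
    (signalMul (Matrix.fromCols 0 1))

theorem upstreamSignals_snd_apply (J : Signal (S.m (i + 1)) →L[ℝ] Signal (S.n i))
    (L : Matrix (Fin (S.n i)) (Fin (S.n (i + 1))) ℝ) (w : C(ℝ, S.Idx (i + 1) → ℝ)) (t : ℝ) :
    (upstreamSignals J L w).2 t = w t ∘ Sum.inr := by
  change Matrix.fromCols 0 1 *ᵥ w t = _
  rw [Matrix.fromCols_mulVec, Matrix.zero_mulVec, Matrix.one_mulVec, zero_add]

theorem upstreamSignals_fst_apply (J : Signal (S.m (i + 1)) →L[ℝ] Signal (S.n i))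
    (L : Matrix (Fin (S.n i)) (Fin (S.n (i + 1))) ℝ) (w : C(ℝ, S.Idx (i + 1) → ℝ)) (t : ℝ) :
    (upstreamSignals J L w).1 t = L *ᵥ (w t ∘ Sum.inl - S.Q (i + 1) *ᵥ (w t ∘ Sum.inr)) +
      J (upstreamSignals J L w).2 t := by
  change (L * Matrix.fromCols 1 (-S.Q (i + 1))) *ᵥ w t + _ = _
  rw [← Matrix.mulVec_mulVec, Matrix.fromCols_mulVec, Matrix.one_mulVec, Matrix.neg_mulVec,
    ← sub_eq_add_neg]
  rfl

/-- One step of the estimation, from the signals of subsystem `i + 1` to those of subsystem `i`. -/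
def upstreamStep (hi : i + 1 ∈ Icc 1 S.N)
    (J : ∀ j, Signal (S.m (j + 1)) →L[ℝ] Signal (S.n j))
    (L : Matrix (Fin (S.n i)) (Fin (S.n (i + 1))) ℝ) :
    Signal (S.n (i + 1)) × Signal (S.m (i + 2)) →L[ℝ] Signal (S.n i) × Signal (S.m (i + 1)) :=
  upstreamSignals (J i) L ∘L charFlow (S.slope (i + 1)) (coupling hi) ∘L outletState (J (i + 1))

theorem hasLookahead_upstreamStep (hi : i + 1 ∈ Icc 1 S.N)
    {J : ∀ j, Signal (S.m (j + 1)) →L[ℝ] Signal (S.n j)} (hJ : IsCausal (J i))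
    (hJ' : IsCausal (J (i + 1))) (L : Matrix (Fin (S.n i)) (Fin (S.n (i + 1))) ℝ) :
    HasLookahead (upstreamStep hi J L) (1 / S.lam1 (i + 1)) := by
  intro s a a' b b' h
  set w := charFlow (S.slope (i + 1)) (coupling hi) (outletState (J (i + 1)) (a, b))
  set w' := charFlow (S.slope (i + 1)) (coupling hi) (outletState (J (i + 1)) (a', b'))
  have hw : ∀ r ≤ s, w r = w' r := fun r hr => by
    refine charFlow_congr_of_le (slope_le hi) fun q hq => ?_
    have hqs : q ≤ s + 1 / S.lam1 (i + 1) := hq.trans (add_le_add_left hr _)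
    rw [outletState_apply, outletState_apply, (h q hqs).1, (h q hqs).2,
      hJ' q b b' fun r hr => (h r (hr.trans hqs)).2]
  change (upstreamSignals (J i) L w).1 s = (upstreamSignals (J i) L w').1 s ∧
    (upstreamSignals (J i) L w).2 s = (upstreamSignals (J i) L w').2 s
  have hsnd : ∀ r ≤ s, (upstreamSignals (J i) L w).2 r = (upstreamSignals (J i) L w').2 r :=
    fun r hr => by rw [upstreamSignals_snd_apply, upstreamSignals_snd_apply, hw r hr]
  refine ⟨?_, hsnd s le_rfl⟩
  rw [upstreamSignals_fst_apply, upstreamSignals_fst_apply, hw s le_rfl, hJ s _ _ hsnd]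

/-- From time `T` on, the signals `z` are the delayed signals `u_i(·,1) + J v_{i+1}(·,0)` and
`v_{i+1}(·,0)`, where `J` acts on the second component of `z`, also before time `T`. -/
def Tracks (J : ∀ j, Signal (S.m (j + 1)) →L[ℝ] Signal (S.n j))
    (u : (i : ℕ) → ℝ → ℝ → Fin (S.n i) → ℝ) (v : (i : ℕ) → ℝ → ℝ → Fin (S.m i) → ℝ) (i : ℕ)
    (τ T : ℝ) (z : Signal (S.n i) × Signal (S.m (i + 1))) : Prop :=
  ∀ s, T ≤ s → z.1 s = u i (s - τ) 1 + J i z.2 s ∧ z.2 s = S.vNext v i (s - τ)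

variable {J : ∀ j, Signal (S.m (j + 1)) →L[ℝ] Signal (S.n j)} {U : ℝ → Fin (S.n 1) → ℝ}
  {u : (i : ℕ) → ℝ → ℝ → Fin (S.n i) → ℝ} {v : (i : ℕ) → ℝ → ℝ → Fin (S.m i) → ℝ} {τ T : ℝ}

theorem Tracks.outletState_eq (hs : S.IsSolution U u v) (hi : i ∈ Icc 1 S.N)
    {z : Signal (S.n i) × Signal (S.m (i + 1))} (hz : Tracks J u v i τ T z) (hT : τ ≤ T) {s : ℝ}
    (hsT : T ≤ s) :
    outletState (J i) z s = Sum.elim (u i (s - τ) 1) (v i (s - τ) 1) := by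
  rw [outletState_apply, (hz s hsT).1, add_sub_cancel_right, (hz s hsT).2,
    hs.bc_v i hi.1 hi.2 _ (sub_nonneg.2 (hT.trans hsT))]

theorem Tracks.upstreamStep (hs : S.IsSolution U u v) (h1 : 1 ≤ i) (hN : i < S.N)
    {L : Matrix (Fin (S.n i)) (Fin (S.n (i + 1))) ℝ} (hL : L * S.Qup i = 1)
    {z : Signal (S.n (i + 1)) × Signal (S.m (i + 2))} (hz : Tracks J u v (i + 1) τ T z)
    (hT : τ ≤ T) :
    Tracks J u v i τ (T + 1 / S.mu1 (i + 1))
      (upstreamStep ⟨Nat.le_add_left 1 i, hN⟩ J L z) := by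
  intro s hsT
  have hi : i + 1 ∈ Icc 1 S.N := ⟨Nat.le_add_left 1 i, hN⟩
  have hsτ : 0 ≤ s - τ :=
    sub_nonneg.2 <| hT.trans <| (le_add_of_nonneg_right (one_div_pos.2 (mu1_pos hi)).le).trans hsT
  set w := charFlow (S.slope (i + 1)) (coupling hi) (outletState (J (i + 1)) z)
  have hw : w s = Sum.elim (u (i + 1) (s - τ) 0) (v (i + 1) (s - τ) 0) :=
    hs.charFlow_eq hi hT (fun r hr => hz.outletState_eq hs hi hT hr) hsT
  change (upstreamSignals (J i) L w).1 s = _ + J i (upstreamSignals (J i) L w).2 s ∧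
    (upstreamSignals (J i) L w).2 s = _
  constructor
  · rw [upstreamSignals_fst_apply, hw, Sum.elim_comp_inl, Sum.elim_comp_inr,
      hs.bc_u i h1 hN _ hsτ, add_sub_cancel_left, Matrix.mulVec_mulVec, hL, Matrix.one_mulVec]
  · rw [upstreamSignals_snd_apply, hw, Sum.elim_comp_inr, vNext, if_pos hN]

theorem Tracks.fst_eq_alpha {κ : S.Kernels} (hi : i ∈ Icc 1 S.N)
    (hJ : ∀ b t, J i b t = ∫ y in (0 : ℝ)..(1 / S.lam1 i), κ.F i 1 y *ᵥ b (t - y))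
    {z : Signal (S.n i) × Signal (S.m (i + 1))} (hz : Tracks J u v i τ T z) {s : ℝ}
    (hs : T + 1 / S.lam1 i ≤ s) : z.1 s = κ.alpha u v i (s - τ) 1 := by
  have hlam : 0 ≤ 1 / S.lam1 i := (one_div_pos.2 (lam1_pos hi)).le
  have hvNext : EqOn (fun y => κ.F i 1 y *ᵥ z.2 (s - y))
      (fun y => κ.F i 1 y *ᵥ S.vNext v i (s - τ - y)) (uIcc 0 (1 / S.lam1 i)) := fun y hy => by
    rw [uIcc_of_le hlam] at hy
    simp only [(hz (s - y) (by linarith [hy.2])).2, sub_right_comm]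
  rw [(hz s (by linarith)).1, hJ, Kernels.alpha, integral_same, add_zero, integral_congr hvNext]

end ChainSystem

section Recursion

theorem sum_Ioc_eq_add {M : Type*} [AddCommMonoid M] (f : ℕ → M) {i N : ℕ} (h : i < N) :
    ∑ j ∈ Finset.Ioc i N, f j = f (i + 1) + ∑ j ∈ Finset.Ioc (i + 1) N, f j := by
  rw [← Finset.insert_Ioc_add_one_left_eq_Ioc h, Finset.sum_insert (by simp)]

theorem exists_downward_recursion {β : ℕ → Type*} [∀ i, Inhabited (β i)] (N : ℕ) (e : β N)
    (step : ∀ i, β (i + 1) → β i) :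
    ∃ f : ∀ i, β i, f N = e ∧ ∀ i < N, f i = step i (f (i + 1)) := by
  induction N generalizing β with
  | zero =>
    exact ⟨fun | 0 => e | _ + 1 => default, rfl, fun i hi => absurd hi (Nat.not_lt_zero i)⟩
  | succ N ih =>
    obtain ⟨f, hf, hstep⟩ := ih (β := fun i => β (i + 1)) e fun i => step (i + 1)
    refine ⟨fun | 0 => step 0 (f 0) | i + 1 => f i, hf, fun i hi => ?_⟩
    cases i with
    | zero => rfl
    | succ i => exact hstep i (Nat.lt_of_succ_lt_succ hi)

end Recursion

section Horizon

variable {p q q' r r' : ℕ}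

/-- The delay `y ↦ y(· - τ)`, with `y` extended to negative times by its value at time zero. -/
def holdDelay (p : ℕ) (τ : ℝ) : Signal p →L[ℝ] Signal p where
  toFun y := y.comp ⟨fun t => max (t - τ) 0, by fun_prop⟩
  map_add' _ _ := rfl
  map_smul' _ _ := rfl
  cont := ContinuousMap.continuous_precomp _

theorem holdDelay_apply (y : Signal p) (τ t : ℝ) : holdDelay p τ y t = y (max (t - τ) 0) :=
  rfl

theorem holdDelay_of_le (y : Signal p) {τ t : ℝ} (h : τ ≤ t) : holdDelay p τ y t = y (t - τ) := by
  rw [holdDelay_apply, max_eq_left (sub_nonneg.2 h)]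

/-- The output signals at time `s` only depend on the measurement on `[0, s + h]`, which is `{0}`
if `s + h` is negative.  The horizon `h` may be negative, as it is for a delay. -/
def HasHorizon (E : Signal p → Signal q × Signal q') (h : ℝ) : Prop :=
  ∀ s, ∀ y y' : Signal p, (∀ t ∈ Icc 0 (max 0 (s + h)), y t = y' t) →
    (E y).1 s = (E y').1 s ∧ (E y).2 s = (E y').2 s

theorem hasHorizon_holdDelay (τ : ℝ) :
    HasHorizon (fun y : Signal p => (holdDelay p τ y, (0 : Signal q))) (-τ) := fun _ _ _ h =>
  ⟨h _ ⟨le_max_right _ _, (max_comm _ _).le⟩, rfl⟩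

theorem HasLookahead.comp_hasHorizon {Φ : Signal q × Signal q' → Signal r × Signal r'}
    {E : Signal p → Signal q × Signal q'} {c h : ℝ} (hΦ : HasLookahead Φ c)
    (hE : HasHorizon E h) : HasHorizon (fun y => Φ (E y)) (c + h) := fun s y y' hy =>
  hΦ s _ _ _ _ fun t ht => hE t y y' fun x hx =>
    hy x ⟨hx.1, hx.2.trans (max_le_max le_rfl (by linarith))⟩

theorem HasHorizon.causalOnWindow {E : Signal p → Signal q × Signal q'} {h w : ℝ}
    (hE : HasHorizon E h) (hw : w + h ≤ 0) :
    CausalOnWindow (fun y => (E y).1) w ∧ CausalOnWindow (fun y => (E y).2) w := by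
  have heq : ∀ t, 0 ≤ t → ∀ y y' : Signal p, (∀ s ∈ Icc 0 t, y s = y' s) → ∀ ν ∈ Icc 0 w,
      (E y).1 (t + ν) = (E y').1 (t + ν) ∧ (E y).2 (t + ν) = (E y').2 (t + ν) :=
    fun t ht y y' hy ν hν => hE _ y y' fun s hs =>
      hy s ⟨hs.1, hs.2.trans (max_le ht (by linarith [hν.2]))⟩
  exact ⟨fun t ht y y' hy ν hν => (heq t ht y y' hy ν hν).1,
    fun t ht y y' hy ν hν => (heq t ht y y' hy ν hν).2⟩

end Horizon

namespace ChainSystem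

variable {S : ChainSystem} {i : ℕ}

theorem exists_isCausal_convolution (hi : i ∈ Icc 1 S.N)
    {H : ℝ → Matrix (Fin (S.n i)) (Fin (S.m (i + 1))) ℝ}
    (hH : ∀ k l, IntervalIntegrable (fun y => H y k l) volume 0 (1 / S.lam1 i)) :
    ∃ J : Signal (S.m (i + 1)) →L[ℝ] Signal (S.n i), IsCausal J ∧
      ∀ b t, J b t = ∫ y in (0 : ℝ)..(1 / S.lam1 i), H y *ᵥ b (t - y) :=
  ⟨convolution (intervalIntegrable_mulVecL hH),
    fun _ _ _ h => convolution_congr _ (one_div_pos.2 (lam1_pos hi)).le h,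
    fun b t => convolution_apply _ b t⟩

theorem exists_upstreamStep (h1 : 1 ≤ i) (hN : i < S.N) (hQ : (S.Qup i).rank = S.n i)
    {J : ∀ j, Signal (S.m (j + 1)) →L[ℝ] Signal (S.n j)} (hJ : IsCausal (J i))
    (hJ' : IsCausal (J (i + 1))) :
    ∃ Φ : Signal (S.n (i + 1)) × Signal (S.m (i + 2)) →L[ℝ] Signal (S.n i) × Signal (S.m (i + 1)),
      HasLookahead Φ (1 / S.lam1 (i + 1)) ∧
      ∀ {U u v}, S.IsSolution U u v → ∀ {τ T}, τ ≤ T → ∀ z, Tracks J u v (i + 1) τ T z →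
        Tracks J u v i τ (T + 1 / S.mu1 (i + 1)) (Φ z) := by
  obtain ⟨L, hL⟩ := exists_leftInverse_of_rank_eq_card (hQ.trans (Fintype.card_fin _).symm)
  exact ⟨upstreamStep ⟨Nat.le_add_left 1 i, hN⟩ J L, hasLookahead_upstreamStep _ hJ hJ' L,
    fun hs _ _ hT _ hz => hz.upstreamStep hs h1 hN hL hT⟩

/-- Estimators that process the measurement, delayed by `τ`, from subsystem `N` back to
subsystem `1` by the steps `Φ`. -/
structure IsEstimator (τ : ℝ)
    (Φ : ∀ i, Signal (S.n (i + 1)) × Signal (S.m (i + 2)) →L[ℝ]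
      Signal (S.n i) × Signal (S.m (i + 1)))
    (E : ∀ i, Signal (S.n S.N) →L[ℝ] Signal (S.n i) × Signal (S.m (i + 1))) : Prop where
  last : E S.N = (holdDelay (S.n S.N) τ).prod 0
  step : ∀ i < S.N, E i = Φ i ∘L E (i + 1)

theorem exists_isEstimator (τ : ℝ)
    (Φ : ∀ i, Signal (S.n (i + 1)) × Signal (S.m (i + 2)) →L[ℝ]
      Signal (S.n i) × Signal (S.m (i + 1))) : ∃ E, IsEstimator τ Φ E := by
  obtain ⟨E, hlast, hstep⟩ := exists_downward_recursion
    (β := fun i => Signal (S.n S.N) →L[ℝ] Signal (S.n i) × Signal (S.m (i + 1))) S.N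
    ((holdDelay (S.n S.N) τ).prod 0) fun i E => Φ i ∘L E
  exact ⟨E, hlast, hstep⟩

variable {τ : ℝ}
  {Φ : ∀ i, Signal (S.n (i + 1)) × Signal (S.m (i + 2)) →L[ℝ]
    Signal (S.n i) × Signal (S.m (i + 1))}
  {E : ∀ i, Signal (S.n S.N) →L[ℝ] Signal (S.n i) × Signal (S.m (i + 1))}

theorem IsEstimator.hasHorizon (hE : IsEstimator τ Φ E)
    (hΦ : ∀ i, 1 ≤ i → i < S.N → HasLookahead (Φ i) (1 / S.lam1 (i + 1))) (hi : i ∈ Icc 1 S.N) :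
    HasHorizon (E i) (∑ j ∈ Finset.Ioc i S.N, 1 / S.lam1 j - τ) := by
  refine Nat.decreasingInduction'
    (P := fun i => HasHorizon (E i) (∑ j ∈ Finset.Ioc i S.N, 1 / S.lam1 j - τ))
    (fun k hk hik ih => ?_) hi.2 ?_
  · rw [hE.step k hk, sum_Ioc_eq_add _ hk, add_sub_assoc]
    exact (hΦ k (hi.1.trans hik) hk).comp_hasHorizon ih
  · rw [hE.last, Finset.Ioc_self, Finset.sum_empty, zero_sub]
    exact hasHorizon_holdDelay τ

theorem IsEstimator.causalOnWindow (hE : IsEstimator τ Φ E)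
    (hΦ : ∀ i, 1 ≤ i → i < S.N → HasLookahead (Φ i) (1 / S.lam1 (i + 1))) (hi : i ∈ Icc 1 S.N)
    (hτ : ∑ j ∈ Finset.Icc 1 S.N, 1 / S.lam1 j ≤ τ) :
    CausalOnWindow (fun y => (E i y).1) (∑ j ∈ Finset.Icc 1 i, 1 / S.lam1 j) ∧
      CausalOnWindow (fun y => (E i y).2) (∑ j ∈ Finset.Icc 1 i, 1 / S.lam1 j) := by
  refine (hE.hasHorizon hΦ hi).causalOnWindow ?_
  rw [← add_sub_assoc, sub_nonpos]
  exact (Finset.sum_Ioc_consecutive (fun j => 1 / S.lam1 j) (Nat.zero_le i) hi.2).trans_le hτ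

theorem IsEstimator.tracks (hE : IsEstimator τ Φ E)
    {J : ∀ j, Signal (S.m (j + 1)) →L[ℝ] Signal (S.n j)} {u : (i : ℕ) → ℝ → ℝ → Fin (S.n i) → ℝ}
    {v : (i : ℕ) → ℝ → ℝ → Fin (S.m i) → ℝ}
    (hΦ : ∀ i, 1 ≤ i → i < S.N → ∀ T, τ ≤ T → ∀ z, Tracks J u v (i + 1) τ T z →
      Tracks J u v i τ (T + 1 / S.mu1 (i + 1)) (Φ i z))
    {y : Signal (S.n S.N)} (hy : ∀ t, 0 ≤ t → y t = u S.N t 1) (hi : i ∈ Icc 1 S.N) :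
    Tracks J u v i τ (τ + ∑ j ∈ Finset.Ioc i S.N, 1 / S.mu1 j) (E i y) := by
  refine Nat.decreasingInduction'
    (P := fun i => Tracks J u v i τ (τ + ∑ j ∈ Finset.Ioc i S.N, 1 / S.mu1 j) (E i y))
    (fun k hk hik ih => ?_) hi.2 fun s hs => ?_
  · have hT : 0 ≤ ∑ j ∈ Finset.Ioc (k + 1) S.N, 1 / S.mu1 j := Finset.sum_nonneg fun j hj =>
      one_div_nonneg.2 (mu1_pos ⟨(Nat.le_add_left 1 k).trans (Finset.mem_Ioc.1 hj).1.le,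
        (Finset.mem_Ioc.1 hj).2⟩).le
    rw [hE.step k hk, sum_Ioc_eq_add _ hk, add_comm (1 / S.mu1 (k + 1)), ← add_assoc]
    exact hΦ k (hi.1.trans hik) hk _ (le_add_of_nonneg_right hT) _ ih
  · rw [Finset.Ioc_self, Finset.sum_empty, add_zero] at hs
    rw [hE.last]
    change holdDelay _ τ y s = _ + J S.N 0 s ∧ (0 : Signal _) s = _
    rw [holdDelay_of_le y hs, hy _ (sub_nonneg.2 hs), map_zero, vNext, if_neg (lt_irrefl _)]
    exact ⟨(add_zero _).symm, rfl⟩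

end ChainSystem

theorem lemma1_general (S : ChainSystem)
    (hQ : ∀ i, 1 ≤ i → i < S.N → (S.Qup i).rank = S.n i) (κ : S.Kernels)
    (hF : ∀ i, 1 ≤ i → i ≤ S.N → ∀ k l,
      IntervalIntegrable (fun y => κ.F i 1 y k l) volume 0 (1 / S.lam1 i))
    (τ : ℝ) (hτ : ∑ j ∈ Finset.Icc 1 S.N, 1 / S.lam1 j ≤ τ) :
    ∃ (A : (i : ℕ) → Signal (S.n S.N) →L[ℝ] Signal (S.n i))
      (V : (i : ℕ) → Signal (S.n S.N) →L[ℝ] Signal (S.m i)),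
      (∀ i, 1 ≤ i → i ≤ S.N →
        CausalOnWindow (A i) (∑ j ∈ Finset.Icc 1 i, 1 / S.lam1 j) ∧
        CausalOnWindow (V (i + 1)) (∑ j ∈ Finset.Icc 1 i, 1 / S.lam1 j) ∧
        ∀ (U : ℝ → Fin (S.n 1) → ℝ) (u : (i : ℕ) → ℝ → ℝ → Fin (S.n i) → ℝ)
          (v : (i : ℕ) → ℝ → ℝ → Fin (S.m i) → ℝ), S.IsSolution U u v →
          ∀ y : Signal (S.n S.N), (∀ t, 0 ≤ t → y t = u S.N t 1) →
          ∀ t, 0 ≤ t → ∀ ν ∈ Set.Icc 0 (∑ j ∈ Finset.Icc 1 i, 1 / S.lam1 j),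
            (τ + 1 / S.lam1 i + ∑ j ∈ Finset.Ioc i S.N, 1 / S.mu1 j ≤ t + ν →
              A i y (t + ν) = delayed τ (fun s => κ.alpha u v i s 1) (t + ν)) ∧
            (τ + ∑ j ∈ Finset.Ioc i S.N, 1 / S.mu1 j ≤ t + ν →
              V (i + 1) y (t + ν) = delayed τ (S.vNext v i) (t + ν))) ∧
      (∀ y, ∀ s, τ ≤ s → A S.N y s = delayed τ y s) ∧ V (S.N + 1) = 0 ∧
      ∀ i, 1 ≤ i → i < S.N →
        ∃ Φ : (Signal (S.n (i + 1)) × Signal (S.m (i + 2))) →L[ℝ]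
            (Signal (S.n i) × Signal (S.m (i + 1))),
          HasLookahead Φ (1 / S.lam1 (i + 1)) ∧
          ∀ y, (A i y, V (i + 1) y) = Φ (A (i + 1) y, V (i + 2) y) := by
  have hdrift := fun i h1 hN => ChainSystem.exists_isCausal_convolution ⟨h1, hN⟩ (hF i h1 hN)
  choose! J hJ hJF using hdrift
  have hstep := fun i h1 hN => ChainSystem.exists_upstreamStep h1 hN (hQ i h1 hN)
    (hJ i h1 hN.le) (hJ (i + 1) (Nat.le_add_left 1 i) hN)
  choose! Φ hlook htrack using hstep
  obtain ⟨E, hE⟩ := ChainSystem.exists_isEstimator τ Φ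
  refine ⟨fun i => .fst ℝ _ _ ∘L E i, fun | 0 => 0 | i + 1 => .snd ℝ _ _ ∘L E i,
    fun i h1 hN => ⟨(hE.causalOnWindow hlook ⟨h1, hN⟩ hτ).1,
      (hE.causalOnWindow hlook ⟨h1, hN⟩ hτ).2, fun U u v hs y hy t _ ν _ => ?_⟩,
    fun y s h => ?_, ?_, fun i h1 hN => ⟨Φ i, hlook i h1 hN, fun y => ?_⟩⟩
  · have htracks := hE.tracks (fun i h1 hN _ hT z => htrack i h1 hN hs hT z) hy ⟨h1, hN⟩
    exact ⟨fun h => htracks.fst_eq_alpha ⟨h1, hN⟩ (hJF i h1 hN) (by linarith),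
      fun h => (htracks _ h).2⟩
  · change (E S.N y).1 s = _
    rw [hE.last]
    exact holdDelay_of_le y h
  · change .snd ℝ _ _ ∘L E S.N = _
    rw [hE.last]
    rfl
  · change E i y = Φ i (E (i + 1) y)
    rw [hE.step i hN]
    rfl

end

theorem lemma1 (S : ChainSystem)
    (hQ : ∀ i, 1 ≤ i → i < S.N → (S.Qup i).rank = S.n i)
    (κ : S.Kernels) (hκ : ∀ i, 1 ≤ i → i ≤ S.N → κ.IsBackstepping i)
    (τ : ℝ) (hτ : ∑ j ∈ Finset.Icc 1 S.N, 1 / S.lam1 j < τ) :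
    ∃ (A : (i : ℕ) → Signal (S.n S.N) →L[ℝ] Signal (S.n i))
      (V : (i : ℕ) → Signal (S.n S.N) →L[ℝ] Signal (S.m i)),
      -- the estimators are causal in the measurement and exact
      (∀ i, 1 ≤ i → i ≤ S.N →
        CausalOnWindow (A i) (∑ j ∈ Finset.Icc 1 i, 1 / S.lam1 j) ∧
        CausalOnWindow (V (i + 1)) (∑ j ∈ Finset.Icc 1 i, 1 / S.lam1 j) ∧
        ∀ (U : ℝ → Fin (S.n 1) → ℝ) (u : (i : ℕ) → ℝ → ℝ → Fin (S.n i) → ℝ)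
          (v : (i : ℕ) → ℝ → ℝ → Fin (S.m i) → ℝ), S.IsSolution U u v →
          ∀ y : Signal (S.n S.N), (∀ t, 0 ≤ t → y t = u S.N t 1) →
          ∀ t, 0 ≤ t → ∀ ν ∈ Set.Icc 0 (∑ j ∈ Finset.Icc 1 i, 1 / S.lam1 j),
            (τ + 1 / S.lam1 i + ∑ j ∈ Finset.Ioc i S.N, 1 / S.mu1 j ≤ t + ν →
              A i y (t + ν) = delayed τ (fun s => κ.alpha u v i s 1) (t + ν)) ∧
            (τ + ∑ j ∈ Finset.Ioc i S.N, 1 / S.mu1 j ≤ t + ν →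
              V (i + 1) y (t + ν) = delayed τ (S.vNext v i) (t + ν))) ∧
      -- they are built recursively, from subsystem `N` back to subsystem `1`
      (∀ y, ∀ s, τ ≤ s → A S.N y s = delayed τ y s) ∧ V (S.N + 1) = 0 ∧
      ∀ i, 1 ≤ i → i < S.N →
        ∃ Φ : (Signal (S.n (i + 1)) × Signal (S.m (i + 2))) →L[ℝ]
            (Signal (S.n i) × Signal (S.m (i + 1))),
          HasLookahead Φ (1 / S.lam1 (i + 1)) ∧
          ∀ y, (A i y, V (i + 1) y) = Φ (A (i + 1) y, V (i + 2) y) :=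
  lemma1_general S hQ κ (fun _ h1 hN => (hκ _ h1 hN).intervalIntegrable_F ⟨h1, hN⟩) τ hτ.le
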